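/- **Definitions.** An oriented groupoid is a small groupoid $G$ with a subcategory $G_+\subset G$ such that $G_+\cap G_+^{-1}$ is the set of identities and $G_+\cup G_+^{-1}=G$. A morphism of oriented groupoids is a functor mapping $G_+$ into $H_+$; it is non-trivial if it does not send every morphism to an identity. The functor $\mathcal P$ from oriented groupoids to small categories sends $(G,G_+)$ to $G_+$. For $m\ge 0$ let $\mathfrak g(m)=(\mathbb Z/(m+1)\mathbb Z)\ltimes\mathbb Z$ be the oriented groupoid of the translation action of $\mathbb Z$: its objects are the elements of $\mathbb Z/(m+1)\mathbb Z$, its morphisms $x\to y$ are the integers $h$ with $h+x=y$, and the positive ones are those with $h\ge 0$. The epicyclic category $\tilde\Lambda$ has as objects the $\mathfrak g(m)$, $m\ge 0$, and as morphisms the non-trivial morphisms of oriented groupoids. The inclusion at $0$ of its isotropy group, with positive generator $m+1$, is an equivalence of $\mathfrak g(m)$ with the one-object category $\mathrm{pt}_{\mathbb Z}$ with endomorphisms $\mathbb Z$; the functor $\mathbf{Mod}:\tilde\Lambda\to\mathbb N^\times$ (the one-object category of the multiplicative monoid of positive integers) sends $f$ to the integer $a\geq 1$ such that, under these equivalences,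 $f$ is isomorphic to the multiplication by $a$ on $\mathbb Z$. For $n\ge 1$ let $[n]_\Lambda$ be the pullback, along the functor $[1]_\Lambda\to \mathrm{pt}_{\mathbb Z}$ induced by the inclusion of monoids $\mathbb Z_{\ge 0}\subset\mathbb Z$, of the discrete bi-fibration over $\mathrm{pt}_{\mathbb Z}$ associated with the $\mathbb Z$-set $\mathbb Z/n\mathbb Z$; its objects are the elements of $\mathbb Z/n\mathbb Z$ and its morphisms $x\to y$ are the integers $a\ge 0$ with $a+x=y$. The endomorphism monoid of each object is $n\mathbb Z_{\ge 0}\cong\mathbb N$; a functor $f:[n]_\Lambda\to[m]_\Lambda$ induces on endomorphisms a morphism $\mathbb N\to\mathbb N$, independent of the object, and $\deg f$ is the integer by which it multiplies. The cyclotomic category $\Lambda R$ has objects $[n]$, $n\ge 1$, and as morphisms $[n]\to[m]$ the functors $[n]_\Lambda\to[m]_\Lambda$ of non-zero degree; $\deg$ is a functor $\Lambda R\to\mathbb N^\times$. Kaledin's cyclic category $\Lambda$ is the subcategory of $\Lambda R$ with the same objects and with the morphisms of degree $1$. **Proposition.** There is an isomorphism of categories $\Phi:\tilde\Lambda\to\Lambda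 R$ induced by $\mathcal P$. Precisely, there are a functor $\Phi:\tilde\Lambda\to\Lambda R$ and isomorphisms of small categories $\mathcal P(X)\cong\Phi(X)_\Lambda$ for $X\in\tilde\Lambda$ (where $\Phi(X)_\Lambda$ denotes $[n]_\Lambda$ if $\Phi(X)=[n]$), natural in $X$, such that: 1. $\Phi(\mathfrak g(m))=[m+1]$ for all $m\ge 0$, and the isomorphism $\mathcal P(\mathfrak g(m))\cong[m+1]_\Lambda$ is the canonical one: the identity on the objects, the elements of $\mathbb Z/(m+1)\mathbb Z$, and on the non-negative integers which define the morphisms; 2. $\Phi$ is an isomorphism of categories; 3. $\deg\circ\,\Phi=\mathbf{Mod}$; 4. $\Phi$ restricts to an isomorphism from the subcategory of $\tilde\Lambda$ with the same objects and with the morphisms $f$ such that $\mathbf{Mod}(f)=1$ onto Kaledin's cyclic category $\Lambda$. -/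

import Mathlib

open CategoryTheory

namespace EpicyclicTheory

universe v u

/-! ### Oriented groupoids -/

/-- A morphism of a category is an identity. -/
def IsIdentity {C : Type u} [Category.{v} C] {x y : C} (f : x ⟶ y) : Prop :=
  ∃ h : x = y, f = eqToHom h

/-- An oriented groupoid `(G, G₊)`: a small groupoid with a subcategory `G₊` such that
`G₊ ∩ G₊⁻¹` is the set of identities and `G₊ ∪ G₊⁻¹ = G`. -/
structure OrientedGroupoid where
  /-- the set of objects of `G` -/
  carrier : Type u
  /-- the groupoid structure -/
  [groupoid : Groupoid.{u} carrier]
  /-- the subcategory `G₊`, as a class of morphisms -/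
  pos : MorphismProperty carrier
  /-- `G₊` contains the identities and is closed under composition -/
  [isMultiplicative : pos.IsMultiplicative]
  inter_eq : ∀ {x y : carrier} (f : x ⟶ y), (pos f ∧ pos (Groupoid.inv f)) ↔ IsIdentity f
  union_eq : ∀ {x y : carrier} (f : x ⟶ y), pos f ∨ pos (Groupoid.inv f)

attribute [instance] OrientedGroupoid.groupoid OrientedGroupoid.isMultiplicative

/-- A morphism of oriented groupoids: a functor mapping `G₊` to `H₊`. -/
@[ext]
structure OrientedGroupoid.Hom (G H : OrientedGroupoid.{u}) where
  /-- the underlying functor -/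
  functor : G.carrier ⥤ H.carrier
  map_pos : ∀ {x y : G.carrier} (f : x ⟶ y), G.pos f → H.pos (functor.map f)

instance : Category OrientedGroupoid.{u} where
  Hom := OrientedGroupoid.Hom
  id G := ⟨𝟭 _, fun _ h => h⟩
  comp f g := ⟨f.functor ⋙ g.functor, fun u h => g.map_pos _ (f.map_pos u h)⟩

/-- A morphism of oriented groupoids is non-trivial if it does not send every morphism to an
identity. -/
def OrientedGroupoid.Nontrivial {G H : OrientedGroupoid.{u}} (f : G ⟶ H) : Prop :=
  ∃ (x y : G.carrier) (w : x ⟶ y), ¬ IsIdentity (f.functor.map w)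

/-- The functor `𝒫` from oriented groupoids to small categories, `(G, G₊) ↦ G₊`. -/
def positivePart : OrientedGroupoid.{u} ⥤ Cat.{u, u} where
  obj G := Cat.of (WideSubcategory G.pos)
  map {G H} f := Functor.toCatHom
    { obj := fun x => ⟨f.functor.obj x.obj⟩
      map := fun w => ⟨f.functor.map w.hom, f.map_pos _ w.property⟩
      map_id := fun x => by
        apply WideSubcategory.hom_ext
        exact f.functor.map_id x.obj
      map_comp := fun w w' => by
        apply WideSubcategory.hom_ext
        exact f.functor.map_comp w.hom w'.hom }

/-! ### The oriented groupoids `𝔤(m)` -/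

/-- The semi-direct product groupoid `(ℤ/n) ⋊ ℤ` of the action of `ℤ` on `ℤ/n` by translation: its
objects are the elements of `ℤ/n`. -/
@[ext]
structure TranslationGroupoid (n : ℕ) where
  /-- the underlying element of `ℤ/n` -/
  pt : ZMod n

namespace TranslationGroupoid

variable {n : ℕ}

/-- A morphism `x ⟶ y` of the semi-direct product groupoid is a pair `(x, h)`, where `h` is an
integer with `h + x = y`. -/
@[ext]
structure Hom (x y : TranslationGroupoid n) where
  /-- the integer `h = ρ(x, h)` -/
  rho : ℤ
  add_eq : (rho : ZMod n) + x.pt = y.pt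

instance : Groupoid (TranslationGroupoid n) where
  Hom := Hom
  id x := ⟨0, by simp⟩
  comp {x y z} f g := ⟨g.rho + f.rho, by
    rw [← g.add_eq, ← f.add_eq]
    push_cast
    ring⟩
  id_comp f := Hom.ext (add_zero _)
  comp_id f := Hom.ext (zero_add _)
  assoc f g h := Hom.ext (add_assoc _ _ _).symm
  inv {x y} f := ⟨-f.rho, by
    rw [← f.add_eq]
    push_cast
    ring⟩
  inv_comp f := Hom.ext (add_neg_cancel _)
  comp_inv f := Hom.ext (neg_add_cancel _)

/-- The canonical homomorphism of groupoids `ρ : (ℤ/n) ⋊ ℤ → ℤ`. -/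
def rho {x y : TranslationGroupoid n} (f : x ⟶ y) : ℤ := Hom.rho f

theorem rho_property {x y : TranslationGroupoid n} (f : x ⟶ y) :
    (rho f : ZMod n) + x.pt = y.pt := Hom.add_eq f

/-- The morphism `x ⟶ y` given by the integer `h` with `h + x = y`. -/
def mk' {x y : TranslationGroupoid n} (h : ℤ) (e : (h : ZMod n) + x.pt = y.pt) : x ⟶ y :=
  Hom.mk h e

@[simp]
theorem rho_mk' {x y : TranslationGroupoid n} (h : ℤ) (e : (h : ZMod n) + x.pt = y.pt) :
    rho (mk' h e) = h := rfl

@[simp]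
theorem rho_id (x : TranslationGroupoid n) : rho (𝟙 x) = 0 := rfl

@[simp]
theorem rho_comp {x y z : TranslationGroupoid n} (f : x ⟶ y) (g : y ⟶ z) :
    rho (f ≫ g) = rho g + rho f := rfl

@[simp]
theorem rho_inv {x y : TranslationGroupoid n} (f : x ⟶ y) :
    rho (Groupoid.inv f) = - rho f := rfl

theorem hom_ext {x y : TranslationGroupoid n} {f g : x ⟶ y} (h : rho f = rho g) : f = g :=
  Hom.ext h

theorem isIdentity_iff {x y : TranslationGroupoid n} (f : x ⟶ y) :
    IsIdentity f ↔ rho f = 0 := by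
  constructor
  · rintro ⟨h, rfl⟩
    cases h
    rfl
  · intro h
    have e : x = y := by
      have := rho_property f
      rw [h] at this
      exact TranslationGroupoid.ext (by simpa using this)
    cases e
    exact ⟨rfl, hom_ext h⟩

end TranslationGroupoid

open TranslationGroupoid

/-- The class of morphisms `ρ⁻¹(ℤ₊)`. -/
def nonnegative (n : ℕ) : MorphismProperty (TranslationGroupoid n) := fun _ _ f => 0 ≤ rho f

instance (n : ℕ) : (nonnegative n).IsMultiplicative where
  id_mem x := le_of_eq (rho_id x).symm
  comp_mem _ g hf hg := add_nonneg (a := rho g) hg hf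

/-- The oriented groupoid `𝔤(m) = (ℤ/(m+1)ℤ) ⋊ ℤ`, with positive part `ρ⁻¹(ℤ₊)`. -/
abbrev frakG (m : ℕ) : OrientedGroupoid.{0} where
  carrier := TranslationGroupoid (m + 1)
  pos := nonnegative (m + 1)
  inter_eq f := by
    rw [isIdentity_iff]
    change (0 ≤ rho f ∧ 0 ≤ - rho f) ↔ _
    omega
  union_eq f := by
    change 0 ≤ rho f ∨ 0 ≤ - rho f
    omega

/-! ### The class of a morphism up to equivalence of small categories -/

/-- The category `pt_ℤ` with one object and with endomorphisms `ℤ`. -/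
abbrev PtZ : Type := SingleObj (Multiplicative ℤ)

/-- The endofunctor of `pt_ℤ` given by the multiplication by `a` in `ℤ`. -/
def mulFunctor (a : ℤ) : PtZ ⥤ PtZ :=
  (AddMonoidHom.toMultiplicative (AddMonoidHom.mulLeft a)).toFunctor

/-- The canonical functor from `pt_ℤ` to the groupoid `𝔤(m)`: it maps the unique object to `0`
and the generator `1` of `ℤ` to the positive generator `m + 1` of the isotropy group of `0`. -/
def isotropy (m : ℕ) : PtZ ⥤ (frakG m).carrier where
  obj _ := ⟨0⟩
  map k := mk' (Multiplicative.toAdd (α := ℤ) k * (m + 1 : ℕ)) (by simp)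
  map_id _ := hom_ext (zero_mul _)
  map_comp a b := hom_ext (by
    rw [rho_comp, rho_mk', rho_mk', rho_mk', ← add_mul]
    rfl)

theorem rho_isotropy {m : ℕ} {x y : PtZ} (k : x ⟶ y) :
    rho ((isotropy m).map k) = Multiplicative.toAdd (α := ℤ) k * (m + 1 : ℕ) := rfl

theorem exists_nonneg_hom {n : ℕ} (x y : TranslationGroupoid (n + 1)) :
    ∃ f : x ⟶ y, 0 ≤ rho f :=
  ⟨mk' (((y.pt - x.pt).val : ℕ) : ℤ) (by
    rw [Int.cast_natCast, ZMod.natCast_zmod_val]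
    ring), Int.natCast_nonneg _⟩

theorem exists_eq_mul_of_loop {n : ℕ} {x : TranslationGroupoid (n + 1)} (f : x ⟶ x) :
    ∃ k : ℤ, rho f = k * (n + 1 : ℕ) := by
  have h := rho_property f
  rw [add_eq_right, ZMod.intCast_zmod_eq_zero_iff_dvd] at h
  obtain ⟨k, hk⟩ := h
  exact ⟨k, by rw [hk, mul_comm]⟩

theorem succ_ne_zero_int (n : ℕ) : ((n + 1 : ℕ) : ℤ) ≠ 0 := by positivity

/-- The groupoid `𝔤(m)` is equivalent to the group `ℤ` (as a category with one object). -/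
instance isotropy_isEquivalence (m : ℕ) : (isotropy m).IsEquivalence where
  faithful := ⟨fun {x y} a b h =>
    mul_right_cancel₀ (M₀ := ℤ) (succ_ne_zero_int m) (congrArg rho h)⟩
  full := ⟨fun {x y} f => by
    obtain ⟨k, hk⟩ := exists_eq_mul_of_loop (n := m) (x := ⟨0⟩) f
    exact ⟨Multiplicative.ofAdd k, hom_ext hk.symm⟩⟩
  essSurj := ⟨fun y => by
    obtain ⟨f, -⟩ := exists_nonneg_hom (n := m) ⟨0⟩ y
    exact ⟨SingleObj.star _, ⟨(Groupoid.isoEquivHom _ _).symm f⟩⟩⟩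

/-- The class of (the functor underlying) `f : 𝔤(m) ⟶ 𝔤(k)` up to equivalence of small
categories is the multiplication by `a` in `ℤ`: when `𝔤(m)` and `𝔤(k)` are replaced by the
equivalent category `pt_ℤ`, the functor `f` becomes isomorphic to the multiplication by `a`. -/
def HasClass {m k : ℕ} (f : frakG m ⟶ frakG k) (a : ℤ) : Prop :=
  Nonempty (isotropy m ⋙ f.functor ≅ mulFunctor a ⋙ isotropy k)

theorem mulFunctor_map (a : ℤ) {x y : PtZ} (k : x ⟶ y) :
    (mulFunctor a).map k = Multiplicative.ofAdd (a * Multiplicative.toAdd (α := ℤ) k) := rfl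

theorem mulFunctor_one : mulFunctor 1 = 𝟭 PtZ :=
  congrArg MonoidHom.toFunctor
    (show AddMonoidHom.toMultiplicative (AddMonoidHom.mulLeft (1 : ℤ)) = MonoidHom.id _ from
      MonoidHom.ext fun k => congrArg Multiplicative.ofAdd (one_mul (Multiplicative.toAdd k)))

theorem mulFunctor_comp (a b : ℤ) : mulFunctor a ⋙ mulFunctor b = mulFunctor (b * a) :=
  congrArg MonoidHom.toFunctor
    (show (AddMonoidHom.toMultiplicative (AddMonoidHom.mulLeft b)).comp
        (AddMonoidHom.toMultiplicative (AddMonoidHom.mulLeft a))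
        = AddMonoidHom.toMultiplicative (AddMonoidHom.mulLeft (b * a)) from
      MonoidHom.ext fun k =>
        congrArg Multiplicative.ofAdd (mul_assoc b a (Multiplicative.toAdd k)).symm)

theorem HasClass.id (m : ℕ) : HasClass (𝟙 (frakG m)) 1 := by
  unfold HasClass
  rw [mulFunctor_one]
  exact ⟨Iso.refl _⟩

theorem HasClass.comp {m k l : ℕ} {f : frakG m ⟶ frakG k} {g : frakG k ⟶ frakG l} {a b : ℤ}
    (hf : HasClass f a) (hg : HasClass g b) : HasClass (f ≫ g) (b * a) := by
  obtain ⟨i⟩ := hf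
  obtain ⟨j⟩ := hg
  unfold HasClass
  rw [← mulFunctor_comp]
  exact ⟨Functor.isoWhiskerRight i g.functor ≪≫ Functor.isoWhiskerLeft (mulFunctor a) j⟩

/-- The positive generator of the isotropy group of `0` in `𝔤(m)`. -/
def generator (m : ℕ) : (⟨0⟩ : TranslationGroupoid (m + 1)) ⟶ ⟨0⟩ :=
  (isotropy m).map (X := SingleObj.star _) (Y := SingleObj.star _) (Multiplicative.ofAdd (1 : ℤ))

theorem HasClass.rho_eq {m k : ℕ} {f : frakG m ⟶ frakG k} {a : ℤ} (hf : HasClass f a) :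
    rho (f.functor.map (generator m)) = a * (k + 1 : ℕ) := by
  obtain ⟨i⟩ := hf
  have h := congrArg rho
    (i.hom.naturality (X := SingleObj.star _) (Y := SingleObj.star _)
      (Multiplicative.ofAdd (1 : ℤ)))
  have h' : rho (i.hom.app (SingleObj.star _)) + rho (f.functor.map (generator m))
    = (a * 1) * (k + 1 : ℕ) + rho (i.hom.app (SingleObj.star _)) := h
  rw [mul_one, add_comm] at h'
  exact add_right_cancel h'

theorem HasClass.unique {m k : ℕ} {f : frakG m ⟶ frakG k} {a b : ℤ} (ha : HasClass f a)
    (hb : HasClass f b) : a = b :=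
  mul_right_cancel₀ (succ_ne_zero_int k) (ha.rho_eq.symm.trans hb.rho_eq)

theorem rho_map_pow {m k : ℕ} (f : frakG m ⟶ frakG k) (c : ℤ)
    (w : (⟨0⟩ : TranslationGroupoid (m + 1)) ⟶ ⟨0⟩) (hw : rho w = c * (m + 1 : ℕ)) :
    rho (f.functor.map w) = c * rho (f.functor.map (generator m)) := by
  let φ : ℤ →+ ℤ :=
    { toFun := fun c => rho (f.functor.map
        ((isotropy m).map (X := SingleObj.star _) (Y := SingleObj.star _) (Multiplicative.ofAdd c)))
      map_zero' := by
        have h : (isotropy m).map (X := SingleObj.star _) (Y := SingleObj.star _)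
          (Multiplicative.ofAdd 0) = 𝟙 _ := (isotropy m).map_id _
        rw [h, f.functor.map_id]
        rfl
      map_add' := fun a b => by
        have h : (isotropy m).map (X := SingleObj.star _) (Y := SingleObj.star _)
          (Multiplicative.ofAdd (a + b)) = (isotropy m).map (X := SingleObj.star _)
            (Y := SingleObj.star _) (Multiplicative.ofAdd b) ≫ (isotropy m).map
            (X := SingleObj.star _) (Y := SingleObj.star _) (Multiplicative.ofAdd a) :=
          (isotropy m).map_comp (X := SingleObj.star _) (Y := SingleObj.star _)
            (Z := SingleObj.star _) (Multiplicative.ofAdd b) (Multiplicative.ofAdd a)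
        rw [h, f.functor.map_comp]
        rfl }
  have h1 : w = (isotropy m).map (X := SingleObj.star _) (Y := SingleObj.star _)
      (Multiplicative.ofAdd c) := hom_ext hw
  have h2 : φ c = c * φ 1 := by
    have := map_zsmul φ c 1
    simpa using this
  rw [h1]
  exact h2

theorem HasClass.nontrivial {m k : ℕ} {f : frakG m ⟶ frakG k} {a : ℕ+}
    (hf : HasClass f ((a : ℕ) : ℤ)) : OrientedGroupoid.Nontrivial f := by
  refine ⟨_, _, generator m, fun h => ?_⟩
  rw [isIdentity_iff, hf.rho_eq] at h
  have ha : ((a : ℕ) : ℤ) ≠ 0 := by exact_mod_cast a.pos.ne'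
  exact mul_ne_zero ha (succ_ne_zero_int k) h

theorem exists_hasClass {m k : ℕ} (f : frakG m ⟶ frakG k) (hf : OrientedGroupoid.Nontrivial f) :
    ∃ a : ℕ+, HasClass f ((a : ℕ) : ℤ) := by
  have nn : ∀ {x y : TranslationGroupoid (m + 1)} (w : x ⟶ y), 0 ≤ rho w →
      0 ≤ rho (f.functor.map w) := fun w hw => f.map_pos w hw
  have hgen : 0 ≤ rho (f.functor.map (generator m)) :=
    nn _ (by
      change (0 : ℤ) ≤ 1 * (m + 1 : ℕ)
      positivity)
  have hne : rho (f.functor.map (generator m)) ≠ 0 := by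
    intro h0
    obtain ⟨x, y, w, hw⟩ := hf
    refine hw ((isIdentity_iff _).2 ?_)
    have key : ∀ {x y : TranslationGroupoid (m + 1)} (w : x ⟶ y), 0 ≤ rho w →
        rho (f.functor.map w) = 0 := by
      intro x y w hw
      obtain ⟨p, hp⟩ := exists_nonneg_hom (n := m) ⟨0⟩ x
      obtain ⟨q, hq⟩ := exists_nonneg_hom (n := m) y ⟨0⟩
      obtain ⟨c, hc⟩ := exists_eq_mul_of_loop (p ≫ w ≫ q)
      have h1 := rho_map_pow f c (p ≫ w ≫ q) hc
      rw [h0, mul_zero, f.functor.map_comp, f.functor.map_comp] at h1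
      have h2 : rho (f.functor.map q) + rho (f.functor.map w) + rho (f.functor.map p) = 0 := h1
      have := nn p hp
      have := nn w hw
      have := nn q hq
      omega
    rcases le_total 0 (rho w) with h | h
    · exact key w h
    · have h1 := key (Groupoid.inv w) (by
        rw [rho_inv]
        omega)
      have h2 : rho (f.functor.map (w ≫ Groupoid.inv w)) = 0 := by
        rw [Groupoid.comp_inv, f.functor.map_id]
        rfl
      rw [f.functor.map_comp] at h2
      have h3 : rho (f.functor.map (Groupoid.inv w)) + rho (f.functor.map w) = 0 := h2
      omega
  obtain ⟨a, ha⟩ := exists_eq_mul_of_loop (n := k) (f.functor.map (generator m))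
  have hapos : 0 < a := by
    have h1 : 0 < a * ((k + 1 : ℕ) : ℤ) := by
      rw [← ha]
      omega
    exact pos_of_mul_pos_left h1 (by positivity)
  refine ⟨⟨a.toNat, by omega⟩, ?_⟩
  have hcast : ((a.toNat : ℕ) : ℤ) = a := Int.toNat_of_nonneg hapos.le
  obtain ⟨u, -⟩ := exists_nonneg_hom (n := k) (f.functor.obj ⟨0⟩) ⟨0⟩
  change HasClass f ((a.toNat : ℕ) : ℤ)
  rw [hcast]
  refine ⟨NatIso.ofComponents (fun _ => (Groupoid.isoEquivHom _ _).symm u) ?_⟩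
  intro x y c
  apply hom_ext
  have h1 := rho_map_pow f (Multiplicative.toAdd (α := ℤ) c) ((isotropy m).map c) rfl
  rw [ha] at h1
  change rho u + rho (f.functor.map ((isotropy m).map c))
    = a * Multiplicative.toAdd (α := ℤ) c * (k + 1 : ℕ) + rho u
  refine (congrArg (rho u + ·) h1).trans ?_
  ring

theorem nontrivial_iff {m k : ℕ} (f : frakG m ⟶ frakG k) :
    OrientedGroupoid.Nontrivial f ↔ ∃ a : ℕ+, HasClass f ((a : ℕ) : ℤ) :=
  ⟨exists_hasClass f, fun ⟨_, h⟩ => h.nontrivial⟩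

/-! ### The epicyclic category and the functor `Mod` -/

/-- The epicyclic category `Λ̃`: its objects are the oriented groupoids `𝔤(m)`, `m ≥ 0`. -/
@[ext]
structure EpicyclicCat where
  /-- the index `m` of `𝔤(m)` -/
  idx : ℕ

/-- The morphisms of `Λ̃` are the non-trivial morphisms of oriented groupoids. -/
instance : Category EpicyclicCat where
  Hom X Y := {f : frakG X.idx ⟶ frakG Y.idx // OrientedGroupoid.Nontrivial f}
  id X := ⟨𝟙 (frakG X.idx), (nontrivial_iff _).2 ⟨1, HasClass.id X.idx⟩⟩
  comp f g := ⟨f.1 ≫ g.1, by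
    obtain ⟨a, ha⟩ := exists_hasClass f.1 f.2
    obtain ⟨b, hb⟩ := exists_hasClass g.1 g.2
    have h := ha.comp hb
    exact (nontrivial_iff _).2 ⟨b * a, by exact_mod_cast h⟩⟩

/-- The inclusion of `Λ̃` in the category of oriented groupoids. -/
def EpicyclicCat.toOrientedGroupoid : EpicyclicCat ⥤ OrientedGroupoid.{0} where
  obj X := frakG X.idx
  map f := f.1

/-- The module of a morphism of `Λ̃`: the positive integer `a` such that the class of the morphism
up to equivalence of small categories is the multiplication by `a`. -/
noncomputable def modOf {X Y : EpicyclicCat} (f : X ⟶ Y) : ℕ+ :=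
  (exists_hasClass f.1 f.2).choose

theorem modOf_spec {X Y : EpicyclicCat} (f : X ⟶ Y) : HasClass f.1 ((modOf f : ℕ) : ℤ) :=
  (exists_hasClass f.1 f.2).choose_spec

theorem modOf_eq {X Y : EpicyclicCat} (f : X ⟶ Y) (a : ℕ+) (h : HasClass f.1 ((a : ℕ) : ℤ)) :
    modOf f = a := by
  have := (modOf_spec f).unique h
  exact_mod_cast this

/-- The functor `Mod : Λ̃ ⥤ ℕ^×`. -/
noncomputable def ModFunctor : EpicyclicCat ⥤ SingleObj ℕ+ where
  obj _ := SingleObj.star _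
  map f := modOf f
  map_id X := modOf_eq _ 1 (HasClass.id X.idx)
  map_comp f g := modOf_eq _ (modOf g * modOf f) (by
    have h := (modOf_spec f).comp (modOf_spec g)
    exact_mod_cast h)

/-- The class of morphisms of `Λ̃` with `Mod = 1`. -/
def modOne : MorphismProperty EpicyclicCat := fun _ _ f => modOf f = 1

instance : modOne.IsMultiplicative where
  id_mem X := ModFunctor.map_id X
  comp_mem f g hf hg := by
    have h : modOf (f ≫ g) = modOf g * modOf f := ModFunctor.map_comp f g
    change modOf (f ≫ g) = 1
    rw [h, show modOf f = 1 from hf, show modOf g = 1 from hg, one_mul]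

/-! ### Kaledin's categories `[n]_Λ` -/

/-- The category `[1]_Λ` with one object and with endomorphisms `ℤ₊ = ℕ`. -/
abbrev PtN : Type := SingleObj (Multiplicative ℕ)

/-- The functor `[1]_Λ ⥤ pt_ℤ` induced by the inclusion `ℤ₊ ⊂ ℤ`. -/
def natToInt : PtN ⥤ PtZ :=
  (AddMonoidHom.toMultiplicative (Nat.castAddMonoidHom ℤ)).toFunctor

/-- The action of `ℤ` on `ℤ/n` by translation. -/
instance translation (n : ℕ+) : MulAction (Multiplicative ℤ) (ZMod n) where
  smul k x := (k.toAdd : ZMod n) + x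
  one_smul x := by
    change (((1 : Multiplicative ℤ).toAdd : ℤ) : ZMod n) + x = x
    simp
  mul_smul a b x := by
    change (((a * b).toAdd : ℤ) : ZMod n) + x = (a.toAdd : ZMod n) + ((b.toAdd : ZMod n) + x)
    simp [add_assoc]

/-- For a `ℤ`-set `S`, the category `[1]_Λ^S`. The discrete bi-fibration over `pt_ℤ` attached to
`S` is the category of elements of `S`, viewed as a functor from `pt_ℤ` to sets; its pullback along
`[1]_Λ ⥤ pt_ℤ` is the category of elements of the composite functor. Thus the objects are the
elements of `S`, and the morphisms `x ⟶ y` are the non-negative integers `a` with `a • x = y`. -/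
abbrev KaledinCat (S : Type) [MulAction (Multiplicative ℤ) S] : Type :=
  (natToInt ⋙ actionAsFunctor (Multiplicative ℤ) S).Elements

/-- The discrete bi-fibration `[1]_Λ^S ⥤ [1]_Λ`. -/
abbrev KaledinCat.proj (S : Type) [MulAction (Multiplicative ℤ) S] : KaledinCat S ⥤ PtN :=
  CategoryOfElements.π _

/-- The category `[n]_Λ`, for a positive integer `n`: the one attached to the `ℤ`-set `ℤ/n`. -/
abbrev BoxCat (n : ℕ+) : Type := KaledinCat (ZMod n)

namespace BoxCat

variable {n m k : ℕ+}

/-- The element of `ℤ/n` underlying an object. -/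
def pt (x : BoxCat n) : ZMod n := x.2

/-- The object attached to an element of `ℤ/n`. -/
def ob (x : ZMod n) : BoxCat n := ⟨SingleObj.star _, x⟩

/-- The non-negative integer underlying a morphism, that is its image in `[1]_Λ`. -/
def label {x y : BoxCat n} (f : x ⟶ y) : ℕ :=
  Multiplicative.toAdd (α := ℕ) ((KaledinCat.proj (ZMod n)).map f)

theorem label_property {x y : BoxCat n} (f : x ⟶ y) :
    (label f : ZMod n) + pt x = pt y := by
  have h : (((label f : ℕ) : ℤ) : ZMod n) + pt x = pt y := f.2
  rwa [Int.cast_natCast] at h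

/-- The morphism `x ⟶ y` given by the non-negative integer `a` with `a + x = y`. -/
def mk {x y : BoxCat n} (a : ℕ) (h : (a : ZMod n) + pt x = pt y) : x ⟶ y :=
  ⟨Multiplicative.ofAdd a, by
    rw [← Int.cast_natCast] at h
    exact h⟩

theorem hom_ext {x y : BoxCat n} {f g : x ⟶ y} (h : label f = label g) : f = g :=
  Subtype.ext h

@[simp]
theorem label_mk {x y : BoxCat n} (a : ℕ) (h : (a : ZMod n) + pt x = pt y) :
    label (mk a h) = a := rfl

@[simp]
theorem label_id (x : BoxCat n) : label (𝟙 x) = 0 := rfl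

@[simp]
theorem label_comp {x y z : BoxCat n} (f : x ⟶ y) (g : y ⟶ z) :
    label (f ≫ g) = label g + label f := rfl

theorem dvd_label {x : BoxCat n} (f : x ⟶ x) : (n : ℕ) ∣ label f := by
  have h := label_property f
  rwa [add_eq_right, ZMod.natCast_eq_zero_iff] at h

/-- The monoid of endomorphisms of an object of `[n]_Λ` is the additive monoid `ℕ`: the integer `j`
corresponds to the endomorphism `j n`. -/
def endEquiv (x : BoxCat n) : Multiplicative ℕ ≃* End x where
  toFun j := mk (x := x) (y := x) (j.toAdd * n) (by simp)
  invFun f := Multiplicative.ofAdd (label (x := x) (y := x) f / n)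
  left_inv j := congrArg Multiplicative.ofAdd (Nat.mul_div_cancel _ n.pos)
  right_inv f := hom_ext (x := x) (y := x) (Nat.div_mul_cancel (dvd_label (x := x) f))
  map_mul' i j := hom_ext (x := x) (y := x) (add_mul i.toAdd j.toAdd (n : ℕ))

/-- The morphism of monoids `ℕ → ℕ` attached to a functor `f : [n]_Λ ⥤ [m]_Λ`: the action of `f`
on the endomorphisms of `x`. It does not depend on `x`, see `degHom_eq`. -/
def degHom (f : BoxCat n ⥤ BoxCat m) (x : BoxCat n) : Multiplicative ℕ →* Multiplicative ℕ :=
  ((endEquiv (f.obj x)).symm.toMonoidHom.comp (f.mapEnd x)).comp (endEquiv x).toMonoidHom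

/-- The degree of a functor `f : [n]_Λ ⥤ [m]_Λ`: the integer `d` such that the corresponding
morphism of monoids `ℕ → ℕ` is the multiplication by `d`. -/
def deg (f : BoxCat n ⥤ BoxCat m) : ℕ :=
  (degHom f (ob 0) (Multiplicative.ofAdd 1)).toAdd

theorem exists_hom (x y : BoxCat n) : Nonempty (x ⟶ y) :=
  ⟨mk (pt y - pt x).val (by
    rw [ZMod.natCast_zmod_val]
    ring)⟩

theorem degHom_eq (f : BoxCat n ⥤ BoxCat m) (x y : BoxCat n) : degHom f x = degHom f y := by
  refine MonoidHom.ext fun j => ?_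
  obtain ⟨u⟩ := exists_hom x y
  have h : endEquiv x j ≫ u = u ≫ endEquiv y j := hom_ext (add_comm _ _)
  have h1 := congrArg (fun w => label (f.map w)) h
  simp only [f.map_comp, label_comp] at h1
  rw [add_comm] at h1
  have h2 := add_right_cancel h1
  exact congrArg (fun a => Multiplicative.ofAdd (a / (m : ℕ))) h2

theorem degHom_apply (f : BoxCat n ⥤ BoxCat m) (x : BoxCat n) (j : ℕ) :
    degHom f x (Multiplicative.ofAdd j) = Multiplicative.ofAdd (deg f * j) := by
  have h1 : (Multiplicative.ofAdd j : Multiplicative ℕ) = Multiplicative.ofAdd 1 ^ j := by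
    rw [← ofAdd_nsmul, smul_eq_mul, mul_one]
  rw [h1, map_pow, degHom_eq f x (ob 0), mul_comm, ← smul_eq_mul, ofAdd_nsmul]
  rfl

theorem deg_id : deg (𝟭 (BoxCat n)) = 1 :=
  congrArg Multiplicative.toAdd ((endEquiv (ob (0 : ZMod n))).symm_apply_apply
    (Multiplicative.ofAdd 1))

theorem degHom_comp (f : BoxCat n ⥤ BoxCat m) (g : BoxCat m ⥤ BoxCat k) (x : BoxCat n) :
    degHom (f ⋙ g) x = (degHom g (f.obj x)).comp (degHom f x) := by
  refine MonoidHom.ext fun j => ?_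
  have h : endEquiv (f.obj x) ((endEquiv (f.obj x)).symm (f.mapEnd x (endEquiv x j)))
      = f.mapEnd x (endEquiv x j) := MulEquiv.apply_symm_apply _ _
  exact congrArg (fun w => (endEquiv (g.obj (f.obj x))).symm (g.mapEnd (f.obj x) w)) h.symm

theorem deg_comp (f : BoxCat n ⥤ BoxCat m) (g : BoxCat m ⥤ BoxCat k) :
    deg (f ⋙ g) = deg g * deg f := by
  have h : degHom (f ⋙ g) (ob 0) (Multiplicative.ofAdd 1)
      = degHom g (f.obj (ob 0)) (Multiplicative.ofAdd (deg f)) := by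
    rw [degHom_comp]
    rfl
  rw [degHom_apply, degHom_apply, mul_one] at h
  exact h

/-- A functor `[n]_Λ ⥤ [m]_Λ` is non-degenerate if its degree is not zero. -/
def NonDegenerate (f : BoxCat n ⥤ BoxCat m) : Prop := deg f ≠ 0

/-- A functor `[n]_Λ ⥤ [m]_Λ` is horizontal if its degree is one. -/
def Horizontal (f : BoxCat n ⥤ BoxCat m) : Prop := deg f = 1

end BoxCat

open BoxCat

/-! ### The cyclotomic and the cyclic category -/

/-- The cyclotomic category `ΛR`: its objects `[n]` are indexed by the positive integers. -/
@[ext]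
structure CyclotomicCat where
  /-- the index `n` of `[n]` -/
  idx : ℕ+

/-- The morphisms `[n] ⟶ [m]` of `ΛR` are the non-degenerate functors `[n]_Λ ⥤ [m]_Λ`. -/
instance : Category CyclotomicCat where
  Hom X Y := {f : BoxCat X.idx ⥤ BoxCat Y.idx // NonDegenerate f}
  id X := ⟨𝟭 _, by
    rw [NonDegenerate, deg_id]
    exact one_ne_zero⟩
  comp f g := ⟨f.1 ⋙ g.1, by
    rw [NonDegenerate, deg_comp]
    exact mul_ne_zero g.2 f.2⟩

/-- The functor from `ΛR` to small categories, `[n] ↦ [n]_Λ`. -/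
def CyclotomicCat.toCat : CyclotomicCat ⥤ Cat.{0, 0} where
  obj X := Cat.of (BoxCat X.idx)
  map f := Functor.toCatHom f.1

/-- The degree functor `deg : ΛR ⥤ ℕ^×`. -/
def degree : CyclotomicCat ⥤ SingleObj ℕ+ where
  obj _ := SingleObj.star _
  map f := (⟨deg f.1, Nat.pos_of_ne_zero f.2⟩ : ℕ+)
  map_id _ := PNat.eq deg_id
  map_comp f g := PNat.eq (deg_comp f.1 g.1)

/-- The class of horizontal morphisms of `ΛR`. -/
def horizontal : MorphismProperty CyclotomicCat := fun _ _ f => Horizontal f.1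

instance : horizontal.IsMultiplicative where
  id_mem _ := deg_id
  comp_mem f g hf hg := by
    change deg (f.1 ⋙ g.1) = 1
    rw [deg_comp, show deg f.1 = 1 from hf, show deg g.1 = 1 from hg]

/-- Kaledin's cyclic category `Λ`: the subcategory of `ΛR` with the same objects whose morphisms
are the horizontal ones. -/
abbrev KaledinCyclicCat : Type := WideSubcategory horizontal

/-- The part `Mod = 1` of the epicyclic category: the subcategory of `Λ̃` with the same objects
whose morphisms are those of module one. -/
abbrev EpicyclicModOne : Type := WideSubcategory modOne

/-- A functor `e : 𝒫(𝔤(m)) ⥤ [n]_Λ` (to be used for `n = m + 1`) is the canonical identification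
if it is the identity on the objects (the residue classes of the integers `j`) and on the integers
that define the morphisms. -/
structure IsCanonical {m : ℕ} {n : ℕ+}
    (e : positivePart.obj (frakG m) ⟶ Cat.of (BoxCat n)) : Prop where
  obj_eq : ∀ j : ℤ, pt (e.toFunctor.obj ⟨⟨(j : ZMod (m + 1))⟩⟩) = (j : ZMod n)
  map_eq : ∀ {x y : WideSubcategory (frakG m).pos} (w : x ⟶ y),
    (label (e.toFunctor.map w) : ℤ) = rho w.hom

end EpicyclicTheory

open EpicyclicTheory

/-! In `𝔤(m)` and in `[m + 1]_Λ` a morphism with given endpoints is determined by one integer, and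
`𝒫(𝔤(m))` has exactly the morphisms of `[m + 1]_Λ`. Conjugating by this identification turns a
morphism `𝔤(m) ⟶ 𝔤(k)` into a functor `[m + 1]_Λ ⥤ [k + 1]_Λ`, so the content is that restriction to
positive parts is bijective on morphisms.

It is injective because every morphism of `𝔤(m)` is positive or inverse to a positive one
(`boxFunctor_injective`). For surjectivity (`boxFunctor_extension`), add `N` full turns `N (m + 1)`
to an integer `h` so that it becomes nonnegative, apply `F`, and subtract the turns `deg F * N * (k
+ 1)` which they contribute. The result does not depend on `N` (`label_map_eq_extendedRho`), and
this independence gives functoriality.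

Both `Mod` and `deg` are read off the image of the positive generator of the isotropy at `0`
(`deg_boxFunctor`). Hence they agree, nontrivial morphisms match functors of nonzero degree, and the
parts of value one correspond. -/

namespace EpicyclicTheory

/-! ### Equality of functors into the two kinds of categories -/

namespace TranslationGroupoid

/-- The transports `eqToHom` demanded by equality of functors are identities, so they add `0` to the
integer and disappear. -/
theorem functor_ext {C : Type*} [Category* C] {n : ℕ} {F G : C ⥤ TranslationGroupoid n}
    (hobj : ∀ x, F.obj x = G.obj x)
    (hmap : ∀ {x y : C} (w : x ⟶ y), rho (F.map w) = rho (G.map w)) : F = G := by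
  refine CategoryTheory.Functor.ext hobj fun x y w => hom_ext ?_
  rw [rho_comp, rho_comp, hmap, (isIdentity_iff _).1 ⟨hobj x, rfl⟩,
    (isIdentity_iff _).1 ⟨(hobj y).symm, rfl⟩, zero_add, add_zero]

end TranslationGroupoid

namespace BoxCat

variable {n : ℕ+}

theorem label_eqToHom {x y : BoxCat n} (h : x = y) : label (eqToHom h) = 0 := by
  cases h
  rfl

theorem functor_ext {C : Type*} [Category* C] {F G : C ⥤ BoxCat n}
    (hobj : ∀ x, F.obj x = G.obj x)
    (hmap : ∀ {x y : C} (w : x ⟶ y), label (F.map w) = label (G.map w)) : F = G := by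
  refine CategoryTheory.Functor.ext hobj fun x y w => hom_ext ?_
  rw [label_comp, label_comp, hmap, label_eqToHom, label_eqToHom, zero_add, add_zero]

end BoxCat

/-! ### The canonical isomorphism on objects and the induced functors -/

open TranslationGroupoid BoxCat

/-- The canonical functor `𝒫(𝔤(m)) ⥤ [m + 1]_Λ`. -/
def positiveToBox (m : ℕ) : WideSubcategory (frakG m).pos ⥤ BoxCat m.succPNat where
  obj x := ob x.obj.pt
  map {x y} w := BoxCat.mk (rho w.hom).toNat (by
    have h := rho_property w.hom
    rw [← Int.toNat_of_nonneg (show 0 ≤ rho w.hom from w.property), Int.cast_natCast] at h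
    exact h)
  map_id x := BoxCat.hom_ext rfl
  -- `Int.toNat` is additive only on nonnegative integers, hence the use of positivity.
  map_comp {x y z} v w := BoxCat.hom_ext
    (Int.toNat_add (show 0 ≤ rho w.hom from w.property) (show 0 ≤ rho v.hom from v.property))

theorem label_positiveToBox {m : ℕ} {x y : WideSubcategory (frakG m).pos} (w : x ⟶ y) :
    (label ((positiveToBox m).map w) : ℤ) = rho w.hom :=
  Int.toNat_of_nonneg w.property

/-- The canonical functor `[m + 1]_Λ ⥤ 𝒫(𝔤(m))`. -/
def boxToPositive (m : ℕ) : BoxCat m.succPNat ⥤ WideSubcategory (frakG m).pos where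
  obj x := ⟨⟨pt x⟩⟩
  map {x y} w := ⟨mk' (label w) (by
    rw [Int.cast_natCast]
    exact label_property w), Int.natCast_nonneg _⟩
  map_id x := WideSubcategory.hom_ext _ (TranslationGroupoid.hom_ext rfl)
  map_comp v w := WideSubcategory.hom_ext _ (TranslationGroupoid.hom_ext (by
    change ((label (v ≫ w) : ℕ) : ℤ) = label w + label v
    rw [label_comp, Nat.cast_add]))

theorem boxToPositive_comp_positiveToBox (m : ℕ) :
    boxToPositive m ⋙ positiveToBox m = 𝟭 _ :=
  BoxCat.functor_ext (fun _ => rfl) fun _ => rfl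

theorem positiveToBox_comp_boxToPositive (m : ℕ) :
    positiveToBox m ⋙ boxToPositive m = 𝟭 _ :=
  CategoryTheory.Functor.hext (fun _ => rfl) fun _ _ w =>
    heq_of_eq (WideSubcategory.hom_ext _ (TranslationGroupoid.hom_ext (label_positiveToBox w)))

/-- The canonical isomorphism of categories `𝒫(𝔤(m)) ≅ [m + 1]_Λ`. -/
def positiveIsoBox (m : ℕ) : positivePart.obj (frakG m) ≅ Cat.of (BoxCat m.succPNat) where
  hom := (positiveToBox m).toCatHom
  inv := (boxToPositive m).toCatHom
  hom_inv_id := Cat.ext (positiveToBox_comp_boxToPositive m)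
  inv_hom_id := Cat.ext (boxToPositive_comp_positiveToBox m)

/-- The functor `𝒫(𝔤(m)) ⥤ 𝒫(𝔤(k))` induced by a morphism `𝔤(m) ⟶ 𝔤(k)`. -/
def positiveFunctor {m k : ℕ} (f : frakG m ⟶ frakG k) :
    WideSubcategory (frakG m).pos ⥤ WideSubcategory (frakG k).pos :=
  (positivePart.map f).toFunctor

/-- The functor `[m + 1]_Λ ⥤ [k + 1]_Λ` induced by a morphism `𝔤(m) ⟶ 𝔤(k)`. -/
def boxFunctor {m k : ℕ} (f : frakG m ⟶ frakG k) : BoxCat m.succPNat ⥤ BoxCat k.succPNat :=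
  boxToPositive m ⋙ positiveFunctor f ⋙ positiveToBox k

theorem label_boxFunctor {m k : ℕ} (f : frakG m ⟶ frakG k) {x y : BoxCat m.succPNat}
    (w : x ⟶ y) :
    (label ((boxFunctor f).map w) : ℤ) = rho (f.functor.map ((boxToPositive m).map w).hom) :=
  label_positiveToBox _

/-- This is the naturality square of the canonical isomorphisms; it also gives the functoriality of
`boxFunctor`. -/
theorem positiveToBox_comp_boxFunctor {m k : ℕ} (f : frakG m ⟶ frakG k) :
    positiveToBox m ⋙ boxFunctor f = positiveFunctor f ⋙ positiveToBox k := by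
  rw [boxFunctor, ← Functor.assoc, positiveToBox_comp_boxToPositive, Functor.id_comp]

theorem boxFunctor_id (m : ℕ) : boxFunctor (𝟙 (frakG m)) = 𝟭 _ :=
  boxToPositive_comp_positiveToBox m

theorem boxFunctor_comp {m k l : ℕ} (f : frakG m ⟶ frakG k) (g : frakG k ⟶ frakG l) :
    boxFunctor (f ≫ g) = boxFunctor f ⋙ boxFunctor g := by
  have h : positiveFunctor (f ≫ g) = positiveFunctor f ⋙ positiveFunctor g := rfl
  rw [boxFunctor, h, boxFunctor, Functor.assoc, Functor.assoc, Functor.assoc,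
    positiveToBox_comp_boxFunctor]

/-- The degree is tested on the loop of one turn at `0`, which corresponds to `generator m`; a
morphism of class `a` sends the latter to `a` turns. -/
theorem deg_boxFunctor {m k : ℕ} {f : frakG m ⟶ frakG k} {a : ℕ} (hf : HasClass f a) :
    deg (boxFunctor f) = a := by
  have hgen : ((boxToPositive m).map (endEquiv (ob 0) (Multiplicative.ofAdd 1))).hom
      = generator m :=
    TranslationGroupoid.hom_ext (Nat.cast_mul 1 (m + 1))
  have h := label_boxFunctor f (endEquiv (ob 0) (Multiplicative.ofAdd 1))
  have h' := (h.trans (congrArg (fun w => rho (f.functor.map w)) hgen)).trans hf.rho_eq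
  rw [← Nat.cast_mul, Nat.cast_inj] at h'
  -- By definition `deg` divides the label of the image loop by `k + 1`.
  exact (congrArg (· / (k + 1)) h').trans (Nat.mul_div_cancel a k.succ_pos)

/-- Agreement on positive morphisms propagates to their inverses, and these two kinds exhaust the
groupoid. -/
theorem boxFunctor_injective {m k : ℕ} {f g : frakG m ⟶ frakG k}
    (h : boxFunctor f = boxFunctor g) : f = g := by
  have hpos : ∀ {x y : TranslationGroupoid (m + 1)} (w : x ⟶ y), 0 ≤ rho w →
      rho (f.functor.map w) = rho (g.functor.map w) := by
    intro x y w hw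
    let p : (⟨x⟩ : WideSubcategory (frakG m).pos) ⟶ ⟨y⟩ := ⟨w, hw⟩
    have hp : ((boxToPositive m).map ((positiveToBox m).map p)).hom = w :=
      TranslationGroupoid.hom_ext (label_positiveToBox p)
    have hf := label_boxFunctor f ((positiveToBox m).map p)
    have hg := label_boxFunctor g ((positiveToBox m).map p)
    have e := congrArg (fun F : BoxCat m.succPNat ⥤ BoxCat k.succPNat =>
      (label (F.map ((positiveToBox m).map p)) : ℤ)) h
    exact (congrArg (fun w => rho (f.functor.map w)) hp).symm.trans
      (hf.symm.trans (e.trans (hg.trans (congrArg (fun w => rho (g.functor.map w)) hp))))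
  refine OrientedGroupoid.Hom.ext (TranslationGroupoid.functor_ext (fun x => ?_) ?_)
  · exact congrArg (fun y : BoxCat k.succPNat => (⟨pt y⟩ : TranslationGroupoid (k + 1)))
      (Functor.congr_obj h (ob x.pt))
  · intro x y w
    rcases le_total 0 (rho w) with hw | hw
    · exact hpos w hw
    · have h1 := hpos (Groupoid.inv w) (by
        rw [rho_inv]
        omega)
      have h2 : ∀ f : frakG m ⟶ frakG k,
          rho (f.functor.map (Groupoid.inv w)) = - rho (f.functor.map w) := fun f => by
        have h := congrArg rho (f.functor.map_comp w (Groupoid.inv w))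
        rw [Groupoid.comp_inv, f.functor.map_id] at h
        exact eq_neg_of_add_eq_zero_left h.symm
      rw [h2, h2] at h1
      exact neg_injective h1

/-! ### Extending a functor from positive parts to groupoids -/

section Extension

variable {m k : ℕ} (F : BoxCat m.succPNat ⥤ BoxCat k.succPNat)

/-- Adding `N` turns is precomposition with the loop of `N` turns at `x`, which `F` sends to the
loop of `deg F * N` turns. -/
theorem BoxCat.label_map_add {n l : ℕ+} (F : BoxCat n ⥤ BoxCat l) {x y : BoxCat n}
    (u v : x ⟶ y) (N : ℕ) (h : label v = label u + N * n) :
    label (F.map v) = label (F.map u) + deg F * N * l := by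
  have hv : v = endEquiv x (Multiplicative.ofAdd N) ≫ u := BoxCat.hom_ext h
  have he : F.map (endEquiv x (Multiplicative.ofAdd N))
      = endEquiv (F.obj x) (Multiplicative.ofAdd (deg F * N)) :=
    (endEquiv (F.obj x)).symm.injective
      ((degHom_apply F x N).trans ((endEquiv (F.obj x)).symm_apply_apply _).symm)
  rw [hv, F.map_comp, label_comp]
  exact congrArg (fun w => label (F.map u) + label w) he

/-- The morphism of `[m + 1]_Λ` given by the integer `h + N (m + 1)`, where `h` defines `w`. -/
def shiftedHom {x y : TranslationGroupoid (m + 1)} (w : x ⟶ y) (N : ℕ)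
    (hN : 0 ≤ rho w + N * (m + 1 : ℕ)) :
    (ob x.pt : BoxCat m.succPNat) ⟶ ob y.pt :=
  BoxCat.mk (rho w + N * (m + 1 : ℕ)).toNat (by
    change (((rho w + N * (m + 1 : ℕ)).toNat : ℕ) : ZMod (m + 1)) + x.pt = y.pt
    rw [← Int.cast_natCast, Int.toNat_of_nonneg hN, Int.cast_add, Int.cast_mul, Int.cast_natCast,
      Int.cast_natCast, ZMod.natCast_self, mul_zero, add_zero]
    exact rho_property w)

theorem label_shiftedHom {x y : TranslationGroupoid (m + 1)} (w : x ⟶ y) (N : ℕ)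
    (hN : 0 ≤ rho w + N * (m + 1 : ℕ)) :
    (label (shiftedHom w N hN) : ℤ) = rho w + N * (m + 1 : ℕ) :=
  Int.toNat_of_nonneg hN

/-- Since a turn has length at least `1`, `|h|` turns always suffice; this gives an explicit default
shift. -/
theorem rho_add_natAbs_mul_nonneg {x y : TranslationGroupoid (m + 1)} (w : x ⟶ y) :
    0 ≤ rho w + (rho w).natAbs * (m + 1 : ℕ) := by
  have h1 : -((rho w).natAbs : ℤ) ≤ rho w := by omega
  have h2 : (0 : ℤ) ≤ (rho w).natAbs * m := by positivity
  push_cast at *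
  linarith

/-- The integer defining the image of `w` under the extension to groupoids of a functor
`[m + 1]_Λ ⥤ [k + 1]_Λ`. -/
def extendedRho {x y : TranslationGroupoid (m + 1)} (w : x ⟶ y) : ℤ :=
  label (F.map (shiftedHom w _ (rho_add_natAbs_mul_nonneg w)))
    - deg F * (rho w).natAbs * (k + 1 : ℕ)

/-- Independence of the number of turns: any nonnegative shift of `w` computes the same integer as
the default one. -/
theorem label_map_eq_extendedRho {x y : TranslationGroupoid (m + 1)} (w : x ⟶ y) (N : ℕ)
    (u : (ob x.pt : BoxCat m.succPNat) ⟶ ob y.pt) (hu : (label u : ℤ) = rho w + N * (m + 1 : ℕ)) :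
    (label (F.map u) : ℤ) = extendedRho F w + deg F * N * (k + 1 : ℕ) := by
  have aux : ∀ (M M' : ℕ) (v v' : (ob x.pt : BoxCat m.succPNat) ⟶ ob y.pt), M ≤ M' →
      (label v : ℤ) = rho w + M * (m + 1 : ℕ) → (label v' : ℤ) = rho w + M' * (m + 1 : ℕ) →
      (label (F.map v') : ℤ) = label (F.map v) + deg F * (M' - M) * (k + 1 : ℕ) := by
    intro M M' v v' hM hv hv'
    have h := BoxCat.label_map_add F v v' (M' - M) (by
      zify [hM]
      rw [hv, hv']
      change _ = _ + _ * ((m + 1 : ℕ) : ℤ)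
      ring)
    rw [h]
    push_cast [Nat.cast_sub hM]
    rfl
  have hs := label_shiftedHom w _ (rho_add_natAbs_mul_nonneg w)
  unfold extendedRho
  -- `aux` only adds turns, so the smaller shift has to play the role of `M`.
  rcases le_total N (rho w).natAbs with h | h
  · rw [aux _ _ _ _ h hu hs]
    ring
  · rw [aux _ _ _ _ h hs hu]
    ring

theorem label_map_eq_extendedRho_of_nonneg {x y : TranslationGroupoid (m + 1)} (w : x ⟶ y)
    (u : (ob x.pt : BoxCat m.succPNat) ⟶ ob y.pt) (hu : (label u : ℤ) = rho w) :
    (label (F.map u) : ℤ) = extendedRho F w := by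
  rw [label_map_eq_extendedRho F w 0 u (by rw [hu, Nat.cast_zero, zero_mul, add_zero]),
    Nat.cast_zero, mul_zero, zero_mul, add_zero]

/-- The subtracted turns are multiples of `k + 1`, so they vanish in `ℤ/(k + 1)`. -/
theorem extendedRho_property {x y : TranslationGroupoid (m + 1)} (w : x ⟶ y) :
    (extendedRho F w : ZMod k.succPNat) + pt (F.obj (ob x.pt)) = pt (F.obj (ob y.pt)) := by
  have h : ((k + 1 : ℕ) : ZMod k.succPNat) = 0 := ZMod.natCast_self (k + 1)
  rw [extendedRho, Int.cast_sub, Int.cast_mul, Int.cast_natCast, Int.cast_natCast, h, mul_zero,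
    sub_zero]
  exact label_property _

theorem extendedRho_comp {x y z : TranslationGroupoid (m + 1)} (v : x ⟶ y) (w : y ⟶ z) :
    extendedRho F (v ≫ w) = extendedRho F w + extendedRho F v := by
  let v' := shiftedHom v _ (rho_add_natAbs_mul_nonneg v)
  let w' := shiftedHom w _ (rho_add_natAbs_mul_nonneg w)
  have hv : (label v' : ℤ) = _ := label_shiftedHom v _ (rho_add_natAbs_mul_nonneg v)
  have hw : (label w' : ℤ) = _ := label_shiftedHom w _ (rho_add_natAbs_mul_nonneg w)
  -- The composite of the two shifts is a shift of `v ≫ w` by the sum of the turns, in general not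
  -- the default number for `v ≫ w`.
  have h := label_map_eq_extendedRho F (v ≫ w) ((rho v).natAbs + (rho w).natAbs) (v' ≫ w') (by
    rw [label_comp, Nat.cast_add, hv, hw, rho_comp, Nat.cast_add (rho v).natAbs]
    ring)
  rw [F.map_comp, label_comp, Nat.cast_add, label_map_eq_extendedRho F v _ v' hv,
    label_map_eq_extendedRho F w _ w' hw, Nat.cast_add (rho v).natAbs] at h
  linarith

/-- The morphism `𝔤(m) ⟶ 𝔤(k)` extending a functor `[m + 1]_Λ ⥤ [k + 1]_Λ`. -/
def extension : frakG m ⟶ frakG k where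
  functor :=
    { obj := fun x => ⟨pt (F.obj (ob x.pt))⟩
      map := fun w => mk' (extendedRho F w) (extendedRho_property F w)
      map_id := fun x => TranslationGroupoid.hom_ext
        ((label_map_eq_extendedRho_of_nonneg F (𝟙 x) (𝟙 _) rfl).symm.trans (by
          rw [F.map_id]
          rfl))
      map_comp := fun v w => TranslationGroupoid.hom_ext (extendedRho_comp F v w) }
  map_pos {x y} w hw := by
    have hu := label_positiveToBox
      (⟨w, hw⟩ : (⟨x⟩ : WideSubcategory (frakG m).pos) ⟶ ⟨y⟩)
    have h := label_map_eq_extendedRho_of_nonneg F w _ hu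
    change 0 ≤ extendedRho F w
    rw [← h]
    exact Int.natCast_nonneg _

/-- A nonnegative integer needs no turns, so the extension agrees with `F` there. -/
theorem boxFunctor_extension : boxFunctor (extension F) = F := by
  refine BoxCat.functor_ext (fun _ => rfl) fun {x y} w => Nat.cast_injective (R := ℤ) ?_
  rw [label_boxFunctor]
  exact (label_map_eq_extendedRho_of_nonneg F ((boxToPositive m).map w).hom w rfl).symm

end Extension

/-! ### Nontriviality and the isomorphism of categories -/

theorem nontrivial_of_deg_ne_zero {m k : ℕ} (f : frakG m ⟶ frakG k)
    (h : deg (boxFunctor f) ≠ 0) : OrientedGroupoid.Nontrivial f := by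
  by_contra hf
  -- If `f` is trivial, the loop that computes the degree is sent to an identity, whose label is
  -- `0`.
  refine h ((congrArg (· / (k + 1)) ?_).trans (Nat.zero_div (k + 1)))
  refine Nat.cast_injective (R := ℤ) ((label_boxFunctor f _).trans ?_)
  refine (isIdentity_iff _).1 (not_not.1 fun hn => hf ⟨_, _, _, hn⟩)

theorem nontrivial_extension {m k : ℕ} (F : BoxCat m.succPNat ⥤ BoxCat k.succPNat)
    (hF : NonDegenerate F) : OrientedGroupoid.Nontrivial (extension F) :=
  nontrivial_of_deg_ne_zero _ (by
    rw [boxFunctor_extension]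
    exact hF)

/-- The functor `Λ̃ ⥤ ΛR` induced by `𝒫`. -/
def epicyclicToCyclotomic : EpicyclicCat ⥤ CyclotomicCat where
  obj X := ⟨X.idx.succPNat⟩
  map f := ⟨boxFunctor f.1, by
    rw [NonDegenerate, deg_boxFunctor (modOf_spec f)]
    exact (modOf f).ne_zero⟩
  map_id X := Subtype.ext (boxFunctor_id X.idx)
  map_comp f g := Subtype.ext (boxFunctor_comp f.1 g.1)

/-- The canonical isomorphisms `𝒫(𝔤(m)) ≅ [m + 1]_Λ` are natural. -/
def positivePartIso :
    EpicyclicCat.toOrientedGroupoid ⋙ positivePart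
      ≅ epicyclicToCyclotomic ⋙ CyclotomicCat.toCat :=
  NatIso.ofComponents (fun X => positiveIsoBox X.idx)
    fun f => Cat.ext (positiveToBox_comp_boxFunctor f.1).symm

theorem isCanonical_positiveToBox (m : ℕ) :
    IsCanonical (m := m) (n := m.succPNat) (positiveToBox m).toCatHom where
  obj_eq _ := rfl
  map_eq w := label_positiveToBox w

instance : epicyclicToCyclotomic.IsIso where
  faithful := ⟨fun h => Subtype.ext (boxFunctor_injective (congrArg Subtype.val h))⟩
  full := ⟨fun g => ⟨⟨extension g.1, nontrivial_extension g.1 g.2⟩, Subtype.ext (boxFunctor_extension g.1)⟩⟩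
  bijective_obj := ⟨fun _ _ h => EpicyclicCat.ext
      (Nat.succPNat_injective (congrArg CyclotomicCat.idx h)),
    fun Y => ⟨⟨Y.idx.natPred⟩, CyclotomicCat.ext Y.idx.succPNat_natPred⟩⟩

/-! ### The part of module one and Kaledin's cyclic category -/

theorem horizontal_map_iff {X Y : EpicyclicCat} (f : X ⟶ Y) :
    horizontal (epicyclicToCyclotomic.map f) ↔ modOne f := by
  change deg (boxFunctor f.1) = 1 ↔ modOf f = 1
  rw [deg_boxFunctor (modOf_spec f), PNat.coe_eq_one_iff]

/-- The functor from the part `Mod = 1` of `Λ̃` to `Λ` induced by `𝒫`. -/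
def modOneToCyclic : EpicyclicModOne ⥤ KaledinCyclicCat where
  obj X := ⟨epicyclicToCyclotomic.obj X.obj⟩
  map f := ⟨epicyclicToCyclotomic.map f.hom, (horizontal_map_iff f.hom).2 f.property⟩
  map_id X := WideSubcategory.hom_ext _ (epicyclicToCyclotomic.map_id X.obj)
  map_comp f g := WideSubcategory.hom_ext _ (epicyclicToCyclotomic.map_comp f.hom g.hom)

instance : modOneToCyclic.IsIso where
  faithful := ⟨fun h => WideSubcategory.hom_ext _
    (epicyclicToCyclotomic.map_injective (congrArg InducedWideCategory.Hom.hom h))⟩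
  full := ⟨fun {X Y} g => by
    obtain ⟨f, hf⟩ := epicyclicToCyclotomic.map_surjective g.hom
    -- The converse half of the equivalence puts the preimage in the part `Mod = 1`.
    refine ⟨⟨f, (horizontal_map_iff f).1 ?_⟩, WideSubcategory.hom_ext _ hf⟩
    rw [hf]
    exact g.property⟩
  bijective_obj := by
    have h := Functor.IsIso.bijective_obj (F := epicyclicToCyclotomic)
    refine ⟨fun X Y e => WideSubcategory.ext (h.1 (congrArg WideSubcategory.obj e)), fun Y => ?_⟩
    obtain ⟨X, hX⟩ := h.2 Y.obj
    exact ⟨⟨X⟩, WideSubcategory.ext hX⟩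

end EpicyclicTheory

theorem mainTheorem6 :
    ∃ (Φ : EpicyclicCat ⥤ CyclotomicCat)
      (η : EpicyclicCat.toOrientedGroupoid ⋙ positivePart ≅ Φ ⋙ CyclotomicCat.toCat),
      (∀ m : ℕ, Φ.obj ⟨m⟩ = ⟨m.succPNat⟩) ∧
      (∀ X : EpicyclicCat,
        IsCanonical (m := X.idx) (n := (Φ.obj X).idx) (η.hom.app X)) ∧
      Φ.IsIso ∧
      Φ ⋙ degree = ModFunctor ∧
      ∃ Θ : EpicyclicModOne ⥤ KaledinCyclicCat,
        Θ.IsIso ∧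
        Θ ⋙ wideSubcategoryInclusion horizontal = wideSubcategoryInclusion modOne ⋙ Φ := by
  refine ⟨epicyclicToCyclotomic, positivePartIso, fun _ => rfl,
    fun X => isCanonical_positiveToBox X.idx, inferInstance, ?_,
    modOneToCyclic, inferInstance, rfl⟩
  -- The target has one object, so only the equality of integers `deg = Mod` remains.
  exact CategoryTheory.Functor.hext (fun _ => rfl) fun _ _ f =>
    heq_of_eq (PNat.eq (deg_boxFunctor (modOf_spec f)))
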